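/- An alternating sign matrix (ASM) is a square matrix with entries in $\{0,1,-1\}$ such that in each row and each column the non-zero entries alternate between $1$ and $-1$ and begin and end with $1$ (in particular, each row and each column has a non-zero entry). For a number $x$, let the $x$-enumeration of $n\times n$ ASMs be $$A(n;x)=\sum_{A} x^{k(A)},$$ where the sum runs over all $n\times n$ ASMs $A$ and $k(A)$ is the number of entries of $A$ equal to $-1$. Then for every integer $n\ge 0$, $$A(n;2)=2^{n(n-1)/2}.$$ -/

import Mathlib

namespace AlternatingSign

/-- A finite sequence of `0`'s, `1`'s and `-1`'s whose non-zero terms alternate between `1` and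
`-1`, begin with `1` and end with `1` (so there is at least one non-zero term). -/
structure IsAlternatingSeq {n : ℕ} (r : Fin n → ℤ) : Prop where
  entries : ∀ i, r i = 0 ∨ r i = 1 ∨ r i = -1
  /-- The first non-zero term exists and is `1`. -/
  begins : ∃ i, r i = 1 ∧ ∀ j, j < i → r j = 0
  /-- The last non-zero term exists and is `1`. -/
  ends : ∃ i, r i = 1 ∧ ∀ j, i < j → r j = 0
  /-- Two consecutive non-zero terms have opposite signs. -/
  alternates : ∀ i j, i < j → r i ≠ 0 → r j ≠ 0 → (∀ k, i < k → k < j → r k = 0) → r j = -r i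

/-- An alternating sign matrix: every row and every column is an alternating sequence. -/
structure IsASM {n : ℕ} (A : Matrix (Fin n) (Fin n) ℤ) : Prop where
  rows : ∀ i, IsAlternatingSeq (fun j => A i j)
  cols : ∀ j, IsAlternatingSeq (fun i => A i j)

theorem finite_setOf_isASM (n : ℕ) : {A : Matrix (Fin n) (Fin n) ℤ | IsASM A}.Finite := by
  have h : (Set.univ.pi fun _ : Fin n => Set.univ.pi fun _ : Fin n => ({0, 1, -1} : Set ℤ)).Finite :=
    Set.Finite.pi fun _ => Set.Finite.pi fun _ => Set.toFinite _
  refine Set.Finite.subset h fun A hA => ?_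
  intro i _ j _
  simpa using (hA.rows i).entries j

/-- The finite set of all `n × n` alternating sign matrices. -/
noncomputable def asmFinset (n : ℕ) : Finset (Matrix (Fin n) (Fin n) ℤ) :=
  (finite_setOf_isASM n).toFinset

/-- The number of entries of `A` equal to `-1`. -/
def numNegOnes {n : ℕ} (A : Matrix (Fin n) (Fin n) ℤ) : ℕ :=
  (Finset.univ.filter fun p : Fin n × Fin n => A p.1 p.2 = -1).card

/-- The `x`-enumeration `A(n; x)` of `n × n` alternating sign matrices: the sum of `x ^ k` over all
such matrices, where `k` is the number of entries equal to `-1`. -/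
noncomputable def xEnumeration (n : ℕ) (x : ℂ) : ℂ :=
  ∑ A ∈ asmFinset n, x ^ numNegOnes A

end AlternatingSign

namespace AlternatingSign

open Finset

/-! ### Alternating sequences and partial sums -/

/-! A sequence alternates, beginning and ending with 1, exactly when its partial sums stay in {0, 1}
and end at 1. Hence ASMs correspond to corner-sum functions: integer arrays with horizontal and
vertical steps 0 or 1 and prescribed boundary values. Continuing the matrix by the identity turns
the boundary values into the uniform formula min(i, j).

The recurrence A(n+1; 2) = 2^n A(n; 2) comes from counting interlacing pairs (s, t) of corner sums
of sizes n+1 and n in two ways. Given s, the values of t are chosen independently, one per cell of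
s: two choices at an entry -1, one elsewhere (`IsCornerSum.interlaces_iff_left`). Given t, the
values of s are chosen independently, two choices at each entry 1 of t and one elsewhere
(`IsCornerSum.isCornerSum_interlaces_iff`). The entries of t's matrix sum to n, so it has n more 1's
than -1's, which gives the factor 2^n. -/

theorem IsAlternatingSeq.of_partialSums {n : ℕ} {r : Fin n → ℤ} {p : ℕ → ℤ} (h0 : p 0 = 0)
    (hstep : ∀ i : Fin n, p (i + 1) = p i + r i) (h01 : ∀ k ≤ n, p k = 0 ∨ p k = 1)
    (hn : p n = 1) : IsAlternatingSeq r := by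
  refine ⟨fun i => ?_, ?_, ?_, ?_⟩
  · have := hstep i
    have := h01 i (by omega)
    have := h01 (i + 1) (by omega)
    omega
  · classical
    -- The first non-zero term is the step by which `p` first reaches 1; below, the last one is the
    -- step leaving the last zero of `p`.
    have hex : ∃ k, p k = 1 := ⟨n, hn⟩
    obtain ⟨hk, hmin⟩ := (Nat.find_eq_iff hex).1 rfl
    have hle : Nat.find hex ≤ n := Nat.find_min' hex hn
    generalize Nat.find hex = k at hk hmin hle
    obtain _ | k := k
    · omega
    · refine ⟨⟨k, hle⟩, ?_, fun j hj => ?_⟩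
      · have h1 := hstep ⟨k, hle⟩
        have h2 := hmin k (by omega)
        have h3 := h01 k (by omega)
        simp only at h1
        omega
      · have hj : (j : ℕ) < k := hj
        have h1 := hstep j
        have h2 := hmin j (by omega)
        have h3 := h01 j (by omega)
        have h4 := hmin (j + 1) (by omega)
        have h5 := h01 (j + 1) (by omega)
        omega
  · have hz : p (Nat.findGreatest (fun k => p k = 0) n) = 0 :=
      Nat.findGreatest_spec (P := fun k => p k = 0) (Nat.zero_le n) h0
    have hmax : ∀ k, Nat.findGreatest (fun k => p k = 0) n < k → k ≤ n → p k ≠ 0 :=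
      fun k h1 h2 => Nat.findGreatest_is_greatest h1 h2
    have hle : Nat.findGreatest (fun k => p k = 0) n ≤ n := Nat.findGreatest_le n
    generalize Nat.findGreatest (fun k => p k = 0) n = k at hz hmax hle
    have hlt : k < n := lt_of_le_of_ne hle (by rintro rfl; omega)
    refine ⟨⟨k, hlt⟩, ?_, fun j hj => ?_⟩
    · have h1 := hstep ⟨k, hlt⟩
      have h2 := hmax (k + 1) (by omega) (by omega)
      have h3 := h01 (k + 1) (by omega)
      simp only at h1
      omega
    · have hj : k < (j : ℕ) := hj
      have h1 := hstep j
      have h2 := hmax j (by omega) (by omega)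
      have h3 := h01 j (by omega)
      have h4 := hmax (j + 1) (by omega) (by omega)
      have h5 := h01 (j + 1) (by omega)
      omega
  · intro i j hij hi hj hbetween
    have hij : (i : ℕ) < j := hij
    have hconst : ∀ k, (i : ℕ) + 1 ≤ k → k ≤ j → p k = p (i + 1) := by
      intro k hk
      induction k, hk using Nat.le_induction with
      | base => intro; rfl
      | succ k hk ih =>
        intro hkj
        have h1 := hstep ⟨k, by omega⟩
        rw [hbetween ⟨k, by omega⟩ (Fin.lt_def.2 (by simp only; omega))
          (Fin.lt_def.2 (by simp only; omega)), add_zero] at h1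
        exact h1.trans (ih (by omega))
    have h1 := hconst j hij le_rfl
    have h2 := hstep i
    have h3 := hstep j
    have h4 := h01 i (by omega)
    have h5 := h01 (i + 1) (by omega)
    have h6 := h01 (j + 1) (by omega)
    omega

theorem IsAlternatingSeq.partialSums {n : ℕ} {r : Fin n → ℤ} (hr : IsAlternatingSeq r) {p : ℕ → ℤ}
    (h0 : p 0 = 0) (hstep : ∀ i : Fin n, p (i + 1) = p i + r i) :
    (∀ k ≤ n, p k = 0 ∨ p k = 1) ∧ p n = 1 := by
  -- The last non-zero term before position k determines the partial sum: 1 after a 1, 0 after a -1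
  -- or if there is none.
  have inv : ∀ k ≤ n, (p k = 0 ∧ ∀ j : Fin n, (j : ℕ) < k → r j = 0) ∨
      ∃ i : Fin n, (i : ℕ) < k ∧ (∀ j : Fin n, i < j → (j : ℕ) < k → r j = 0) ∧
        ((r i = 1 ∧ p k = 1) ∨ (r i = -1 ∧ p k = 0)) := by
    intro k
    induction k with
    | zero => exact fun _ => Or.inl ⟨h0, fun j hj => absurd hj (Nat.not_lt_zero _)⟩
    | succ k ih =>
      intro hk
      have hs := hstep ⟨k, hk⟩
      simp only at hs
      have hlast : ∀ j : Fin n, (j : ℕ) < k + 1 → (j : ℕ) < k ∨ j = ⟨k, hk⟩ := fun j hj => by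
        rw [Fin.ext_iff]; simp only; omega
      by_cases hrk : r ⟨k, hk⟩ = 0
      · rw [hrk, add_zero] at hs
        rw [hs]
        refine (ih (by omega)).imp (fun h => ⟨h.1, fun j hj => ?_⟩) ?_
        · rcases hlast j hj with h' | rfl
          exacts [h.2 j h', hrk]
        · rintro ⟨i, hi, hz, hp⟩
          refine ⟨i, by omega, fun j hij hj => ?_, hp⟩
          rcases hlast j hj with h' | rfl
          exacts [hz j hij h', hrk]
      · refine Or.inr ⟨⟨k, hk⟩, Nat.lt_succ_self k, fun j hij hj => ?_, ?_⟩
        · have : k < (j : ℕ) := hij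
          omega
        · rcases ih (by omega) with ⟨hp, hz⟩ | ⟨i, hi, hz, hp⟩
          · obtain ⟨i, hi1, hi2⟩ := hr.begins
            have : i = ⟨k, hk⟩ := by
              rcases lt_trichotomy i ⟨k, hk⟩ with h | h | h
              · have := hz i h
                omega
              · exact h
              · exact absurd (hi2 _ h) hrk
            subst this
            omega
          · have := hr.alternates i ⟨k, hk⟩ hi (by omega) hrk fun j h1 h2 => hz j h1 h2
            omega
  refine ⟨fun k hk => ?_, ?_⟩
  · rcases inv k hk with h | ⟨i, -, -, h⟩ <;> omega
  · obtain ⟨i, hi, hz⟩ := hr.ends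
    rcases inv n le_rfl with h | ⟨j, -, hzj, h⟩
    · have := h.2 i i.2
      omega
    · have hji : ¬ j < i := fun hlt => by
        have := hzj i hlt i.2
        omega
      have hij : ¬ i < j := fun hlt => by
        have := hz j hlt
        omega
      obtain rfl : i = j := le_antisymm (not_lt.1 hji) (not_lt.1 hij)
      omega

/-! ### Corner sums -/

/-- The second mixed difference of `s`: the matrix whose corner sums are `s`. -/
def mixedDiff (s : ℕ → ℕ → ℤ) (i j : ℕ) : ℤ :=
  s (i + 1) (j + 1) - s i (j + 1) - s (i + 1) j + s i j

/-- The corner-sum functions of the `n × n` alternating sign matrices, the matrix being continued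
by the identity matrix to an infinite one. -/
structure IsCornerSum (n : ℕ) (s : ℕ → ℕ → ℤ) : Prop where
  row : ∀ i j, s i (j + 1) = s i j ∨ s i (j + 1) = s i j + 1
  col : ∀ i j, s (i + 1) j = s i j ∨ s (i + 1) j = s i j + 1
  left : ∀ i, s i 0 = 0
  top : ∀ j, s 0 j = 0
  outside : ∀ i j, n ≤ i ∨ n ≤ j → s i j = min (i : ℤ) j

/-- The `n × n` matrix with corner sums `s`. -/
def toMatrix (n : ℕ) (s : ℕ → ℕ → ℤ) : Matrix (Fin n) (Fin n) ℤ :=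
  fun i j => mixedDiff s i j

/-- Partial sums of a row or column of mixed differences telescope to a single step of `s`, which is
0 or 1. -/
theorem IsCornerSum.isASM {n : ℕ} {s : ℕ → ℕ → ℤ} (hs : IsCornerSum n s) :
    IsASM (toMatrix n s) := by
  constructor
  · intro i
    refine .of_partialSums (p := fun j => s (i + 1) j - s i j) ?_ ?_ ?_ ?_
    · simp [hs.left]
    · intro j
      simp only [toMatrix, mixedDiff]
      ring
    · intro k _
      have := hs.col i k
      omega
    · have h1 := hs.outside i n (Or.inr le_rfl)
      have h2 := hs.outside (i + 1) n (Or.inr le_rfl)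
      push_cast at h2
      omega
  · intro j
    refine .of_partialSums (p := fun i => s i (j + 1) - s i j) ?_ ?_ ?_ ?_
    · simp [hs.top]
    · intro i
      simp only [toMatrix, mixedDiff]
      ring
    · intro k _
      have := hs.row k j
      omega
    · have h1 := hs.outside n j (Or.inl le_rfl)
      have h2 := hs.outside n (j + 1) (Or.inl le_rfl)
      push_cast at h2
      omega

theorem IsCornerSum.toMatrix_injOn (n : ℕ) : Set.InjOn (toMatrix n) {s | IsCornerSum n s} := by
  intro s hs t ht h
  have hd : ∀ i < n, ∀ j < n, mixedDiff s i j = mixedDiff t i j := fun i hi j hj =>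
    congrFun (congrFun h ⟨i, hi⟩) ⟨j, hj⟩
  have key : ∀ i j, s i j = t i j := by
    intro i
    induction i with
    | zero => intro j; rw [hs.top, ht.top]
    | succ i ih =>
      intro j
      induction j with
      | zero => rw [hs.left, ht.left]
      | succ j ihj =>
        by_cases hij : i < n ∧ j < n
        · have h1 := hd i hij.1 j hij.2
          have h2 := ih j
          have h3 := ih (j + 1)
          simp only [mixedDiff] at h1
          omega
        · rw [hs.outside _ _ (by omega), ht.outside _ _ (by omega)]
  exact funext fun i => funext fun j => key i j

/-- The continuation of a square matrix by the identity matrix. -/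
def extend {n : ℕ} (A : Matrix (Fin n) (Fin n) ℤ) (i j : ℕ) : ℤ :=
  if h : i < n ∧ j < n then A ⟨i, h.1⟩ ⟨j, h.2⟩ else if i = j then 1 else 0

/-- The corner sums of `A`, continued by the identity matrix. -/
def cornerSum {n : ℕ} (A : Matrix (Fin n) (Fin n) ℤ) (i j : ℕ) : ℤ :=
  ∑ x ∈ range i, ∑ y ∈ range j, extend A x y

theorem cornerSum_succ_left {n : ℕ} (A : Matrix (Fin n) (Fin n) ℤ) (i j : ℕ) :
    cornerSum A (i + 1) j = cornerSum A i j + ∑ y ∈ range j, extend A i y :=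
  sum_range_succ _ _

theorem extend_transpose {n : ℕ} (A : Matrix (Fin n) (Fin n) ℤ) (i j : ℕ) :
    extend A.transpose i j = extend A j i := by
  simp only [extend, Matrix.transpose_apply, and_comm, eq_comm]

theorem cornerSum_transpose {n : ℕ} (A : Matrix (Fin n) (Fin n) ℤ) (i j : ℕ) :
    cornerSum A.transpose i j = cornerSum A j i := by
  simp only [cornerSum, extend_transpose]
  exact sum_comm

theorem IsASM.transpose {n : ℕ} {A : Matrix (Fin n) (Fin n) ℤ} (hA : IsASM A) :
    IsASM A.transpose :=
  ⟨hA.cols, hA.rows⟩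

theorem toMatrix_cornerSum {n : ℕ} (A : Matrix (Fin n) (Fin n) ℤ) :
    toMatrix n (cornerSum A) = A := by
  ext i j
  have h : extend A i j = A i j := by simp [extend]
  simp only [toMatrix, mixedDiff, cornerSum_succ_left, sum_range_succ, h]
  ring

/-- Rows below the matrix are identity rows; a row of the matrix is continued by zeros, so its sum
stays 1. -/
theorem IsASM.rowSum_extend {n : ℕ} {A : Matrix (Fin n) (Fin n) ℤ} (hA : IsASM A) (i j : ℕ) :
    (∑ y ∈ range j, extend A i y = 0 ∨ ∑ y ∈ range j, extend A i y = 1) ∧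
      (n ≤ i ∨ n ≤ j → ∑ y ∈ range j, extend A i y = if i < j then 1 else 0) := by
  have hid : n ≤ i → ∑ y ∈ range j, extend A i y = if i < j then 1 else 0 := by
    intro hi
    have : ∀ y, extend A i y = if i = y then 1 else 0 := fun y => by
      rw [extend, dif_neg (by omega)]
    simp [this]
  rcases le_or_gt n i with hi | hi
  · rw [hid hi]
    split_ifs <;> simp
  · have hp := (hA.rows ⟨i, hi⟩).partialSums (p := fun j => ∑ y ∈ range j, extend A i y) (by simp)
      (fun y => by simp [sum_range_succ, extend, hi])
    have hlarge : ∀ j, n ≤ j → ∑ y ∈ range j, extend A i y = 1 := by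
      intro j hj
      induction j, hj using Nat.le_induction with
      | base => exact hp.2
      | succ j hj ih =>
        rw [sum_range_succ, ih, extend, dif_neg (by omega), if_neg (by omega), add_zero]
    refine ⟨?_, fun h => ?_⟩
    · rcases le_or_gt n j with hj | hj
      · exact Or.inr (hlarge j hj)
      · exact hp.1 j hj.le
    · rw [hlarge j (by omega), if_pos (by omega)]

theorem IsASM.cornerSum_outside {n : ℕ} {A : Matrix (Fin n) (Fin n) ℤ} (hA : IsASM A) (i j : ℕ)
    (hj : n ≤ j) : cornerSum A i j = min (i : ℤ) j := by
  induction i with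
  | zero => simp [cornerSum]
  | succ i ih =>
    rw [cornerSum_succ_left, ih, (hA.rowSum_extend i j).2 (Or.inr hj)]
    push_cast
    split_ifs <;> omega

theorem IsASM.isCornerSum {n : ℕ} {A : Matrix (Fin n) (Fin n) ℤ} (hA : IsASM A) :
    IsCornerSum n (cornerSum A) := by
  have hcol : ∀ {B : Matrix (Fin n) (Fin n) ℤ}, IsASM B → ∀ i j,
      cornerSum B (i + 1) j = cornerSum B i j ∨ cornerSum B (i + 1) j = cornerSum B i j + 1 := by
    intro B hB i j
    rw [cornerSum_succ_left]
    rcases (hB.rowSum_extend i j).1 with h | h <;> rw [h] <;> simp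
  refine ⟨fun i j => ?_, hcol hA, fun i => ?_, fun j => ?_, fun i j h => ?_⟩
  · simpa only [cornerSum_transpose] using hcol hA.transpose j i
  · simp [cornerSum]
  · simp [cornerSum]
  · rcases h with h | h
    · rw [← cornerSum_transpose, hA.transpose.cornerSum_outside j i h, min_comm]
    · exact hA.cornerSum_outside i j h

/-- The corner-sum functions of the `n × n` alternating sign matrices. -/
noncomputable def cornerSums (n : ℕ) : Finset (ℕ → ℕ → ℤ) :=
  open Classical in (asmFinset n).image cornerSum

theorem mem_asmFinset {n : ℕ} {A : Matrix (Fin n) (Fin n) ℤ} : A ∈ asmFinset n ↔ IsASM A := by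
  simp [asmFinset]

theorem mem_cornerSums {n : ℕ} {s : ℕ → ℕ → ℤ} : s ∈ cornerSums n ↔ IsCornerSum n s := by
  simp only [cornerSums, mem_image, mem_asmFinset]
  constructor
  · rintro ⟨A, hA, rfl⟩
    exact hA.isCornerSum
  · intro hs
    exact ⟨toMatrix n s, hs.isASM,
      IsCornerSum.toMatrix_injOn n hs.isASM.isCornerSum hs (toMatrix_cornerSum _)⟩

/-- The cells of the `n × n` square where the mixed difference of `s` is `c`. -/
def cells (n : ℕ) (c : ℤ) (s : ℕ → ℕ → ℤ) : Finset (ℕ × ℕ) :=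
  {p ∈ range n ×ˢ range n | mixedDiff s p.1 p.2 = c}

theorem mem_cells {n : ℕ} {c : ℤ} {s : ℕ → ℕ → ℤ} {i j : ℕ} :
    (i, j) ∈ cells n c s ↔ (i < n ∧ j < n) ∧ mixedDiff s i j = c := by
  simp [cells]

theorem numNegOnes_toMatrix (n : ℕ) (s : ℕ → ℕ → ℤ) :
    numNegOnes (toMatrix n s) = #(cells n (-1) s) := by
  refine card_bij (fun p _ => ((p.1 : ℕ), (p.2 : ℕ))) ?_ ?_ ?_
  · intro p hp
    rw [mem_cells]
    exact ⟨⟨p.1.2, p.2.2⟩, (mem_filter.1 hp).2⟩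
  · intro p _ q _ h
    simpa [Prod.ext_iff, Fin.ext_iff] using h
  · rintro ⟨i, j⟩ h
    rw [mem_cells] at h
    exact ⟨(⟨i, h.1.1⟩, ⟨j, h.1.2⟩), mem_filter.2 ⟨mem_univ _, h.2⟩, rfl⟩

theorem xEnumeration_eq_sum_cornerSums (n : ℕ) (x : ℂ) :
    xEnumeration n x = ∑ s ∈ cornerSums n, x ^ #(cells n (-1) s) := by
  refine sum_bij' (fun A _ => cornerSum A) (fun s _ => toMatrix n s) ?_ ?_ ?_ ?_ ?_
  · exact fun A hA => mem_cornerSums.2 (mem_asmFinset.1 hA).isCornerSum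
  · exact fun s hs => mem_asmFinset.2 (mem_cornerSums.1 hs).isASM
  · exact fun A _ => toMatrix_cornerSum A
  · intro s hs
    rw [mem_cornerSums] at hs
    exact IsCornerSum.toMatrix_injOn n hs.isASM.isCornerSum hs (toMatrix_cornerSum _)
  · intro A _
    rw [← numNegOnes_toMatrix, toMatrix_cornerSum]

theorem IsCornerSum.mixedDiff_cases {n : ℕ} {s : ℕ → ℕ → ℤ} (hs : IsCornerSum n s) (i j : ℕ) :
    mixedDiff s i j = 0 ∨ mixedDiff s i j = 1 ∨ mixedDiff s i j = -1 := by
  have h1 := hs.row i j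
  have h2 := hs.row (i + 1) j
  simp only [mixedDiff]
  omega

/-- The entries of an alternating sign matrix have sum `n`. -/
theorem IsCornerSum.card_cells_one {n : ℕ} {s : ℕ → ℕ → ℤ} (hs : IsCornerSum n s) :
    #(cells n 1 s) = #(cells n (-1) s) + n := by
  have hrow : ∀ i, ∑ j ∈ range n, mixedDiff s i j = s (i + 1) n - s i n := by
    intro i
    have := sum_range_sub (fun j => s (i + 1) j - s i j) n
    simp only [hs.left, sub_zero] at this
    rw [← this]
    exact sum_congr rfl fun j _ => by simp only [mixedDiff]; ring
  have hsum : ∑ p ∈ range n ×ˢ range n, mixedDiff s p.1 p.2 = n := by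
    rw [sum_product, sum_congr rfl fun i _ => hrow i, sum_range_sub (fun i => s i n), hs.top,
      hs.outside n n (Or.inl le_rfl)]
    simp
  have hcount : ∑ p ∈ range n ×ˢ range n, mixedDiff s p.1 p.2 =
      #(cells n 1 s) - #(cells n (-1) s) := by
    simp only [cells, card_filter, Nat.cast_sum]
    rw [← sum_sub_distrib]
    refine sum_congr rfl fun p _ => ?_
    rcases hs.mixedDiff_cases p.1 p.2 with h | h | h <;> simp [h]
  omega

/-! ### Interlacing corner sums -/

/-- The interlacing relation between corner sums of sizes `n + 1` and `n`. -/
def Interlaces (s t : ℕ → ℕ → ℤ) : Prop :=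
  ∀ i j, s i j ≤ t i j ∧ s (i + 1) (j + 1) ≤ t i j + 1 ∧ t i j ≤ s (i + 1) j ∧ t i j ≤ s i (j + 1)

/-- Functions squeezed between `lo` and `lo` plus the indicator function of `D`. -/
theorem card_eq_two_pow_of_mem_iff {F : Finset (ℕ → ℕ → ℤ)} (lo : ℕ → ℕ → ℤ) (D : Finset (ℕ × ℕ))
    (hF : ∀ t, t ∈ F ↔ ∀ i j, lo i j ≤ t i j ∧ t i j ≤ lo i j + if (i, j) ∈ D then 1 else 0) :
    #F = 2 ^ #D := by
  rw [← card_powerset]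
  refine card_bij' (fun t _ => {p ∈ D | t p.1 p.2 ≠ lo p.1 p.2})
    (fun S _ i j => lo i j + if (i, j) ∈ S then 1 else 0) ?_ ?_ ?_ ?_
  · exact fun t _ => mem_powerset.2 (filter_subset _ _)
  · intro S hS
    refine (hF _).2 fun i j => ?_
    have : (i, j) ∈ S → (i, j) ∈ D := fun h => mem_powerset.1 hS h
    split_ifs <;> first | omega | tauto
  · intro t ht
    ext i j
    have := (hF t).1 ht i j
    simp only [mem_filter]
    by_cases hD : (i, j) ∈ D <;> by_cases hlo : t i j = lo i j <;> simp [hD, hlo] at this ⊢ <;> omega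
  · intro S hS
    ext ⟨i, j⟩
    have : (i, j) ∈ S → (i, j) ∈ D := fun h => mem_powerset.1 hS h
    simp only [mem_filter, ne_eq, add_eq_left, ite_eq_right_iff, one_ne_zero, imp_false, not_not]
    tauto

/-- Two neighbouring values of `t` share two values of `s`: one separates them, the other keeps them
within distance 1. -/
theorem IsCornerSum.of_interlaces {n : ℕ} {s t : ℕ → ℕ → ℤ} (hs : IsCornerSum (n + 1) s)
    (h : Interlaces s t) : IsCornerSum n t := by
  refine ⟨fun i j => ?_, fun i j => ?_, fun i => ?_, fun j => ?_, fun i j hij => ?_⟩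
  · have h1 := h i j
    have h2 := h i (j + 1)
    omega
  · have h1 := h i j
    have h2 := h (i + 1) j
    omega
  · have h1 := h i 0
    have h2 := hs.left i
    have h3 := hs.left (i + 1)
    omega
  · have h1 := h 0 j
    have h2 := hs.top j
    have h3 := hs.top (j + 1)
    omega
  · have h1 := h i j
    have h2 := hs.outside (i + 1) (j + 1) (by omega)
    have h3 := hs.row (i + 1) j
    have h4 := hs.col i (j + 1)
    rcases le_total j i with hji | hji
    · have h5 := hs.outside (i + 1) j (by omega)
      push_cast at h2 h5
      omega
    · have h5 := hs.outside i (j + 1) (by omega)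
      push_cast at h2 h5
      omega

/-- `t i j` sits at the centre of a cell of `s`. With corner values a, b above and c, d below, it
ranges from max(a, d - 1) to min(b, c). As steps are 0 or 1, these bounds agree unless b = c = d = a
+ 1, the case of mixed difference -1. -/
theorem IsCornerSum.interlaces_iff_left {n : ℕ} {s : ℕ → ℕ → ℤ} (hs : IsCornerSum n s)
    (t : ℕ → ℕ → ℤ) :
    Interlaces s t ↔ ∀ i j, max (s i j) (s (i + 1) (j + 1) - 1) ≤ t i j ∧
      t i j ≤ max (s i j) (s (i + 1) (j + 1) - 1) + if (i, j) ∈ cells n (-1) s then 1 else 0 := by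
  refine forall_congr' fun i => forall_congr' fun j => ?_
  -- Outside the square the mixed differences are those of min(i, j), never -1.
  have hmem : (i, j) ∈ cells n (-1) s ↔ mixedDiff s i j = -1 := by
    rw [mem_cells, and_iff_right_iff_imp]
    intro h
    by_contra hij
    have h1 := hs.outside (i + 1) (j + 1) (by omega)
    have h2 := hs.row (i + 1) j
    have h3 := hs.col i (j + 1)
    simp only [mixedDiff] at h
    push_cast at h1
    have h4 := hs.outside (i + 1) j
    have h5 := hs.outside i (j + 1)
    have h6 := hs.row i j
    have h7 := hs.col i j
    push_cast at h4 h5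
    omega
  have h1 := hs.row i j
  have h2 := hs.row (i + 1) j
  have h3 := hs.col i j
  have h4 := hs.col i (j + 1)
  simp only [hmem, mixedDiff]
  split_ifs <;> omega

/-- The smallest corner sum of size `n + 1` interlacing `t`. -/
def lowerInterlacing (n : ℕ) (t : ℕ → ℕ → ℤ) : ℕ → ℕ → ℤ
  | 0, _ => 0
  | _ + 1, 0 => 0
  | i + 1, j + 1 =>
    if i < n ∧ j < n then max (t i (j + 1)) (t (i + 1) j) else min ((i : ℤ) + 1) (j + 1)

/-- The cells of `t` with mixed difference `1`, as positions between the four cell corners. -/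
def shiftedCells (n : ℕ) (t : ℕ → ℕ → ℤ) : Finset (ℕ × ℕ) :=
  (cells n 1 t).map ⟨fun p => (p.1 + 1, p.2 + 1), fun p q h => by simpa [Prod.ext_iff] using h⟩

theorem mem_shiftedCells {n : ℕ} {t : ℕ → ℕ → ℤ} {i j : ℕ} :
    (i, j) ∈ shiftedCells n t ↔ ∃ i' j', i = i' + 1 ∧ j = j' + 1 ∧ (i', j') ∈ cells n 1 t := by
  simp only [shiftedCells, mem_map, Prod.exists]
  constructor
  · rintro ⟨a, b, h, hab⟩
    obtain ⟨rfl, rfl⟩ := Prod.mk.inj hab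
    exact ⟨a, b, rfl, rfl, h⟩
  · rintro ⟨a, b, rfl, rfl, h⟩
    exact ⟨a, b, h, rfl⟩

/-- Now `s` sits at the cell centres of `t`, between max(b, c) and min(d, a + 1); these differ only
if b = c = a and d = a + 1, the case of mixed difference 1. Interlacing alone does not fix the
boundary values of `s`, so being a corner sum has to be required too. -/
theorem IsCornerSum.isCornerSum_interlaces_iff {n : ℕ} {t : ℕ → ℕ → ℤ} (ht : IsCornerSum n t)
    (s : ℕ → ℕ → ℤ) :
    IsCornerSum (n + 1) s ∧ Interlaces s t ↔ ∀ i j, lowerInterlacing n t i j ≤ s i j ∧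
      s i j ≤ lowerInterlacing n t i j + if (i, j) ∈ shiftedCells n t then 1 else 0 := by
  have hedge : ∀ i j, t i (j + 1) = t i j ∨ t i (j + 1) = t i j + 1 := ht.row
  have hedge' : ∀ i j, t (i + 1) j = t i j ∨ t (i + 1) j = t i j + 1 := ht.col
  constructor
  · rintro ⟨hs, h⟩ (_ | i) (_ | j)
    · simp [lowerInterlacing, mem_shiftedCells, hs.top]
    · simp [lowerInterlacing, mem_shiftedCells, hs.top]
    · simp [lowerInterlacing, mem_shiftedCells, hs.left]
    · by_cases hij : i < n ∧ j < n
      · simp only [lowerInterlacing, mem_shiftedCells, Nat.add_right_cancel_iff,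
          exists_and_left, exists_eq_left', mem_cells, hij, and_self, if_true, true_and, mixedDiff]
        have h1 := h i j
        have h2 := h i (j + 1)
        have h3 := h (i + 1) j
        have h4 := h (i + 1) (j + 1)
        have h5 := hedge i j
        have h6 := hedge (i + 1) j
        have h7 := hedge' i j
        have h8 := hedge' i (j + 1)
        split_ifs <;> omega
      · have h1 := hs.outside (i + 1) (j + 1) (by omega)
        push_cast at h1
        simp [lowerInterlacing, mem_shiftedCells, mem_cells, hij, h1]
  · intro h
    have htop : ∀ j, s 0 j = 0 := fun j => by
      have := h 0 j
      simp [lowerInterlacing, mem_shiftedCells] at this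
      omega
    have hleft : ∀ i, s i 0 = 0 := fun i => by
      have := h i 0
      cases i <;> simp [lowerInterlacing, mem_shiftedCells] at this <;> omega
    have hout : ∀ i j, n + 1 ≤ i ∨ n + 1 ≤ j → s i j = min (i : ℤ) j := by
      rintro (_ | i) (_ | j) hij
      · simp [htop]
      · rw [htop]; push_cast; omega
      · rw [hleft]; push_cast; omega
      · have := h (i + 1) (j + 1)
        have hij' : ¬ (i < n ∧ j < n) := by omega
        simp [lowerInterlacing, mem_shiftedCells, mem_cells, hij'] at this
        push_cast
        omega
    have hin : ∀ i j, i < n → j < n → t i (j + 1) ≤ s (i + 1) (j + 1) ∧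
        t (i + 1) j ≤ s (i + 1) (j + 1) ∧ s (i + 1) (j + 1) ≤ t (i + 1) (j + 1) ∧
        s (i + 1) (j + 1) ≤ t i j + 1 := by
      intro i j hi hj
      have := h (i + 1) (j + 1)
      simp only [lowerInterlacing, mem_shiftedCells, Nat.add_right_cancel_iff,
        exists_and_left, exists_eq_left', mem_cells, hi, hj, and_self, if_true, true_and,
        mixedDiff] at this
      have h5 := hedge i j
      have h6 := hedge (i + 1) j
      have h7 := hedge' i j
      have h8 := hedge' i (j + 1)
      split_ifs at this <;> omega
    have hout' : ∀ i j, ¬ (i < n ∧ j < n) → s (i + 1) (j + 1) = min ((i : ℤ) + 1) (j + 1) := by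
      intro i j hij
      have := hout (i + 1) (j + 1) (by omega)
      push_cast at this
      exact this
    have hint : Interlaces s t := by
      refine fun i j => ⟨?_, ?_, ?_, ?_⟩
      · obtain _ | i := i
        · rw [htop, ht.top]
        obtain _ | j := j
        · rw [hleft, ht.left]
        by_cases hij : i < n ∧ j < n
        · exact (hin i j hij.1 hij.2).2.2.1
        · rw [hout' i j hij, ht.outside _ _ (by omega)]
          push_cast
          exact le_rfl
      · by_cases hij : i < n ∧ j < n
        · exact (hin i j hij.1 hij.2).2.2.2
        · rw [hout' i j hij, ht.outside _ _ (by omega)]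
          omega
      · obtain _ | j := j
        · rw [hleft, ht.left]
        by_cases hij : i < n ∧ j < n
        · exact (hin i j hij.1 hij.2).1
        · rw [hout' i j hij, ht.outside _ _ (by omega)]
          push_cast
          omega
      · obtain _ | i := i
        · rw [htop, ht.top]
        by_cases hij : i < n ∧ j < n
        · exact (hin i j hij.1 hij.2).2.1
        · rw [hout' i j hij, ht.outside _ _ (by omega)]
          push_cast
          omega
    refine ⟨⟨fun i j => ?_, fun i j => ?_, hleft, htop, hout⟩, hint⟩
    -- A value of `t` separates neighbouring values of `s`, and another bounds their difference by
    -- 1.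
    · obtain _ | i := i
      · simp [htop]
      · have h1 := hint i j
        have h2 := hint (i + 1) j
        omega
    · obtain _ | j := j
      · simp [hleft]
      · have h1 := hint i j
        have h2 := hint i (j + 1)
        omega

/-- Double counting of the interlacing pairs. -/
theorem xEnumeration_two_succ (n : ℕ) :
    xEnumeration (n + 1) 2 = 2 ^ n * xEnumeration n 2 := by
  classical
  have hleft : ∀ s ∈ cornerSums (n + 1),
      #(bipartiteAbove Interlaces (cornerSums n) s) = 2 ^ #(cells (n + 1) (-1) s) := by
    intro s hs
    rw [mem_cornerSums] at hs
    refine card_eq_two_pow_of_mem_iff (fun i j => max (s i j) (s (i + 1) (j + 1) - 1))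
      (cells (n + 1) (-1) s) fun t => ?_
    rw [mem_bipartiteAbove, mem_cornerSums, ← hs.interlaces_iff_left]
    exact and_iff_right_of_imp hs.of_interlaces
  have hright : ∀ t ∈ cornerSums n,
      #(bipartiteBelow Interlaces (cornerSums (n + 1)) t) = 2 ^ n * 2 ^ #(cells n (-1) t) := by
    intro t ht
    rw [mem_cornerSums] at ht
    have hcard : #(shiftedCells n t) = n + #(cells n (-1) t) := by
      rw [shiftedCells, card_map, ht.card_cells_one, add_comm]
    rw [← pow_add, ← hcard]
    refine card_eq_two_pow_of_mem_iff (lowerInterlacing n t) (shiftedCells n t) fun s => ?_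
    rw [mem_bipartiteBelow, mem_cornerSums, ht.isCornerSum_interlaces_iff]
  have h := sum_card_bipartiteAbove_eq_sum_card_bipartiteBelow Interlaces
    (s := cornerSums (n + 1)) (t := cornerSums n)
  rw [sum_congr rfl hleft, sum_congr rfl hright, ← mul_sum] at h
  rw [xEnumeration_eq_sum_cornerSums, xEnumeration_eq_sum_cornerSums]
  exact_mod_cast h

theorem xEnumeration_zero (x : ℂ) : xEnumeration 0 x = 1 := by
  have h : asmFinset 0 = {0} := by
    ext A
    simp only [mem_asmFinset, mem_singleton]
    exact ⟨fun _ => Subsingleton.elim _ _, fun _ => ⟨fun i => i.elim0, fun j => j.elim0⟩⟩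
  simp [xEnumeration, h, numNegOnes]

end AlternatingSign

theorem mainTheorem3 (n : ℕ) :
    AlternatingSign.xEnumeration n 2 = 2 ^ (n * (n - 1) / 2) := by
  -- Writing the exponent as 0 + 1 + ... + (n - 1) lets the induction avoid truncated subtraction
  -- and division.
  rw [← Finset.sum_range_id]
  induction n with
  | zero => simp [AlternatingSign.xEnumeration_zero]
  | succ n ih =>
    rw [AlternatingSign.xEnumeration_two_succ, ih, Finset.sum_range_succ, pow_add, mul_comm]
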